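/- Let $F$ be a field of characteristic zero, let $X=\{x_1,x_2,\dots\}$ be a countably infinite set of variables, and let $W_X(F)=\operatorname{Der}_F F[X]$ be the Lie algebra of all $F$-derivations $\sum_{i\ge 1} f_i\,\partial/\partial x_i$ ($f_i\in F[X]$) of the polynomial algebra $F[X]$, with the commutator bracket. For $n\ge 1$ let $W_n(F)=\operatorname{Der}F[x_1,\dots,x_n]$ be regarded as the subalgebra of $W_X(F)$ of all vector fields $\sum_{i=1}^n f_i\,\partial/\partial x_i$ with $f_i\in F[x_1,\dots,x_n]$, and let $W_\infty(F)=\bigcup_{n\ge1}W_n(F)$. Let $W_{\mathrm{fin}}(F)\subseteq W_X(F)$ be the subalgebra of all $\sum_{i\ge1} f_i\,\partial/\partial x_i$ such that each variable $x_n$ occurs in only finitely many of the polynomials $f_i$. Then for every ($F$-linear) derivation $d$ of the Lie algebra $W_\infty(F)$ there is an element $a\in W_{\mathrm{fin}}(F)$ such that $d(x)=[x,a]$ for all $x\in W_\infty(F)$. Moreover, not every derivation of $W_\infty(F)$ is inner: there is a derivation of $W_\infty(F)$ that is not of the form $x\mapsto[x,b]$ with $b\in W_\infty(F)$. -/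

import Mathlib

namespace PolyVect

open MvPolynomial

/-- The polynomial algebra `F[X]` on the countably many variables `x₁, x₂, …`;
the variable `x_{i+1}` is `X i`, for `i : ℕ`. -/
abbrev Poly (F : Type*) [Field F] : Type _ := MvPolynomial ℕ F

/-- The Lie algebra `W_X(F) = Der F[X]`, with the commutator bracket. The element
`∑ f_i ∂/∂x_i` is the derivation `D` with `D (X i) = f_i` (`MvPolynomial.mkDerivation`). -/
abbrev WX (F : Type*) [Field F] : Type _ := Derivation F (Poly F) (Poly F)

theorem apply_mem_supported {F : Type*} [Field F] (D : WX F) {s t : Set ℕ} (hst : s ⊆ t)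
    (hD : ∀ i ∈ s, D (X i) ∈ supported F t) {p : Poly F} (hp : p ∈ supported F s) :
    D p ∈ supported F t := by
  have hp' : p ∈ Algebra.adjoin F (X '' s) := hp
  induction hp' using Algebra.adjoin_induction with
  | mem x hx =>
    obtain ⟨i, hi, rfl⟩ := hx
    exact hD i hi
  | algebraMap r => simp
  | add x y hx hy ihx ihy =>
    rw [map_add]
    exact add_mem (ihx hx) (ihy hy)
  | mul x y hx hy ihx ihy =>
    rw [Derivation.leibniz, smul_eq_mul, smul_eq_mul]
    exact add_mem (mul_mem (supported_mono hst hx) (ihy hy))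
      (mul_mem (supported_mono hst hy) (ihx hx))

/-- The Lie algebra `W_n(F)`, as a subalgebra of `W_X(F)`: the vector fields
`∑_{i ≤ n} f_i ∂/∂x_i` whose coefficients are polynomials in `x₁, …, x_n`. -/
def Wn (F : Type*) [Field F] (n : ℕ) : LieSubalgebra F (WX F) where
  carrier := {D | (∀ i, i < n → D (X i) ∈ supported F (Set.Iio n)) ∧ ∀ i, n ≤ i → D (X i) = 0}
  zero_mem' := ⟨fun _ _ => by simp, fun _ _ => by simp⟩
  add_mem' := by
    rintro D E ⟨hD, hD'⟩ ⟨hE, hE'⟩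
    exact ⟨fun i hi => add_mem (hD i hi) (hE i hi), fun i hi => by simp [hD' i hi, hE' i hi]⟩
  smul_mem' := by
    rintro c D ⟨hD, hD'⟩
    exact ⟨fun i hi => Subalgebra.smul_mem _ (hD i hi) c, fun i hi => by simp [hD' i hi]⟩
  lie_mem' := by
    rintro D E ⟨hD, hD'⟩ ⟨hE, hE'⟩
    refine ⟨fun i hi => ?_, fun i hi => ?_⟩
    · rw [Derivation.commutator_apply]
      exact sub_mem (apply_mem_supported D subset_rfl hD (hE i hi))
        (apply_mem_supported E subset_rfl hE (hD i hi))
    · simp [Derivation.commutator_apply, hD' i hi, hE' i hi]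

theorem Wn_mono (F : Type*) [Field F] : Monotone (Wn F) := by
  rintro m n hmn D ⟨hD, hD'⟩
  refine ⟨fun i _ => ?_, fun i hi => hD' i (hmn.trans hi)⟩
  rcases lt_or_ge i m with h | h
  · exact supported_mono (Set.Iio_subset_Iio hmn) (hD i h)
  · rw [hD' i h]
    exact zero_mem _

/-- The Lie algebra `W_∞(F)`, the union of the ascending chain of the `W_n(F)`. -/
def Winf (F : Type*) [Field F] : LieSubalgebra F (WX F) where
  carrier := ⋃ n, (Wn F n : Set (WX F))
  zero_mem' := Set.mem_iUnion.2 ⟨0, zero_mem _⟩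
  add_mem' := by
    intro D E hD hE
    obtain ⟨m, hm⟩ := Set.mem_iUnion.1 hD
    obtain ⟨n, hn⟩ := Set.mem_iUnion.1 hE
    exact Set.mem_iUnion.2 ⟨max m n, add_mem (Wn_mono F (le_max_left m n) hm)
      (Wn_mono F (le_max_right m n) hn)⟩
  smul_mem' := by
    intro c D hD
    obtain ⟨m, hm⟩ := Set.mem_iUnion.1 hD
    exact Set.mem_iUnion.2 ⟨m, (Wn F m).smul_mem c hm⟩
  lie_mem' := by
    intro D E hD hE
    obtain ⟨m, hm⟩ := Set.mem_iUnion.1 hD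
    obtain ⟨n, hn⟩ := Set.mem_iUnion.1 hE
    exact Set.mem_iUnion.2 ⟨max m n, (Wn F (max m n)).lie_mem
      (Wn_mono F (le_max_left m n) hm) (Wn_mono F (le_max_right m n) hn)⟩

theorem finite_mem_vars_apply {F : Type*} [Field F] {D E : WX F}
    (hD : ∀ n, {i : ℕ | n ∈ (D (X i)).vars}.Finite)
    (hE : ∀ n, {i : ℕ | n ∈ (E (X i)).vars}.Finite) (n : ℕ) :
    {i : ℕ | n ∈ (D (E (X i))).vars}.Finite := by
  refine ((hE n).union ((hD n).biUnion fun j _ => hE j)).subset fun i hi => ?_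
  by_contra hcon
  simp only [Set.mem_union, Set.mem_iUnion, Set.mem_ofPred_eq, not_or, not_exists] at hcon hi
  have h : D (E (X i)) ∈ supported F ({n}ᶜ : Set ℕ) := by
    refine apply_mem_supported D (s := ↑(E (X i)).vars) ?_ ?_ (mem_supported.2 subset_rfl)
    · intro j hj hjn
      rw [Set.mem_singleton_iff] at hjn
      subst hjn
      exact hcon.1 hj
    · intro j hj
      rw [mem_supported]
      intro k hk hkn
      rw [Set.mem_singleton_iff] at hkn
      subst hkn
      exact hcon.2 j hk hj
  exact mem_supported.1 h hi rfl

/-- The Lie algebra `W_fin(F)`: the vector fields `∑ f_i ∂/∂x_i`, `f_i ∈ F[X]`, such that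
each variable occurs in only finitely many of the polynomials `f_i`. -/
def Wfin (F : Type*) [Field F] : LieSubalgebra F (WX F) where
  carrier := {D | ∀ n : ℕ, {i : ℕ | n ∈ (D (X i)).vars}.Finite}
  zero_mem' := fun n => by simp
  add_mem' := by
    classical
    intro D E hD hE n
    refine ((hD n).union (hE n)).subset fun i hi => ?_
    have h := vars_add_subset (D (X i)) (E (X i)) hi
    simpa using h
  smul_mem' := by
    intro c D hD n
    refine (hD n).subset fun i hi => ?_
    have h : c • D (X i) ∈ supported F (↑(D (X i)).vars : Set ℕ) :=
      Subalgebra.smul_mem _ (mem_supported.2 subset_rfl) c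
    exact mem_supported.1 h hi
  lie_mem' := by
    classical
    intro D E hD hE n
    refine ((finite_mem_vars_apply hD hE n).union (finite_mem_vars_apply hE hD n)).subset
      fun i hi => ?_
    have hi' : n ∈ (D (E (X i)) - E (D (X i))).vars := by
      rw [← Derivation.commutator_apply]
      exact hi
    have h := vars_sub_subset (D (E (X i))) hi'
    simpa using h

end PolyVect

/-!
Let `D` be a derivation of `W_∞(F)` with values in `W_X(F)`, and write `∂_i = ∂/∂x_i`. Since the
`∂_i` commute, for each `k` the `x_k`-coefficients of the fields `D(∂_i)` form a closed one-form,
and `[∂_i, x_k ∂_k] = 0` for `i ≠ k` shows that only finitely many of these coefficients are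
nonzero. By the Poincaré lemma there is thus a field `a` such that `D` and `[·, a]` agree on all
`∂_i`. What is left after subtracting `[·, a]` sends every `x_i ∂_i` to a constant field, and
subtracting `[·, c]` for a suitable constant field `c` makes these values zero. A derivation
killing all `∂_i` and all `x_i ∂_i` preserves weights and, by induction on the monomial, has
constant values on the fields `x^s ∂_j`; comparing weights, it vanishes. So `D` is `[·, a]` for
some `a` in `W_X(F)`.

If `D` takes values in `W_∞(F)`, then `a` normalizes `W_∞(F)`, and the normalizer is `W_fin(F)`,
as `[∂_n, a]` is in `W_∞(F)` exactly when `x_n` occurs in finitely many coefficients of `a`. The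
Euler field `∑ x_i ∂_i` is in `W_fin(F)`, but `[∂_n, ∑ x_i ∂_i] = ∂_n` for all `n`, whereas an
element `b` of `W_∞(F)` has no `x_n`-coefficient for large `n`.
-/

namespace PolyVect

open MvPolynomial

section LieAlgebra

variable {R L : Type*} [CommRing R] [LieRing L] [LieAlgebra R L] {H : LieSubalgebra R L}

/-- A derivation of a Lie subalgebra `H ⊆ L`, regarded as a derivation with values in the
`H`-module `L`. -/
def ambientDerivation (D : LieDerivation R H H) : LieDerivation R H L where
  __ := H.toSubmodule.subtype ∘ₗ (D : H →ₗ[R] H)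
  leibniz' x y := congrArg Subtype.val (D.apply_lie_eq_sub x y)

/-- The derivation `x ↦ [x, a]` of a Lie subalgebra `H` defined by an element `a` of its
normalizer. -/
def normalizerDerivation {a : L} (ha : a ∈ H.normalizer) : LieDerivation R H H where
  __ := ((LieDerivation.inner R H L a : LieDerivation R H L) : H →ₗ[R] L).codRestrict H.toSubmodule
    fun x => (H.mem_normalizer_iff' a).1 ha x x.2
  leibniz' x y := Subtype.ext ((LieDerivation.inner R H L a).apply_lie_eq_sub x y)

theorem coe_normalizerDerivation_apply {a : L} (ha : a ∈ H.normalizer) (x : H) :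
    (normalizerDerivation ha x : L) = ⁅(x : L), a⁆ := rfl

end LieAlgebra

section Polynomial

variable {σ R : Type*} [CommSemiring R]

theorem derivation_apply_eq_sum_pderiv {A : Type*} [AddCommMonoid A] [Module R A]
    [Module (MvPolynomial σ R) A] [IsScalarTower R (MvPolynomial σ R) A]
    (D : Derivation R (MvPolynomial σ R) A) {p : MvPolynomial σ R} {S : Finset σ}
    (hS : ∀ i ∉ S, pderiv i p = 0) : D p = ∑ i ∈ S, pderiv i p • D (X i) := by
  classical
  let E : Derivation R (MvPolynomial σ R) A :=
    ∑ i ∈ S ∪ p.vars, (LinearMap.toSpanSingleton _ A (D (X i))).compDer (pderiv i)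
  have hE : ∀ q, E q = ∑ i ∈ S ∪ p.vars, pderiv i q • D (X i) := fun q => by
    simp only [E, ← Derivation.coeFnAddMonoidHom_apply, map_sum, Finset.sum_apply]
    rfl
  have hDE : D p = E p := derivation_eq_of_forall_mem_vars fun k hk => by
    simp [hE, pderiv_X, Pi.single_apply, ite_smul, hk]
  rw [hDE, hE]
  refine (Finset.sum_subset Finset.subset_union_left fun i _ hi => ?_).symm
  rw [hS i hi, zero_smul]

theorem pderiv_ne_zero_of_mem_vars [IsAddTorsionFree R] {p : MvPolynomial σ R} {i : σ}
    (hi : i ∈ p.vars) : pderiv i p ≠ 0 := by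
  obtain ⟨s, hs, his⟩ := (mem_vars_iff_mem_support i).1 hi
  have hle : Finsupp.single i 1 ≤ s :=
    Finsupp.single_le_iff.2 (Nat.one_le_iff_ne_zero.2 (Finsupp.mem_support_iff.1 his))
  refine ne_zero_iff.2 ⟨s - Finsupp.single i 1, ?_⟩
  rw [coeff_pderiv, tsub_add_cancel_of_le hle, ← Nat.cast_succ, mul_comm, ← nsmul_eq_mul]
  exact smul_ne_zero (Nat.succ_ne_zero _) (mem_support_iff.1 hs)

theorem exists_eq_C_of_pderiv_eq_zero [IsAddTorsionFree R] {p : MvPolynomial σ R}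
    (h : ∀ i, pderiv i p = 0) : ∃ c, p = C c :=
  ⟨_, vars_eq_empty_iff_eq_C.1 <|
    Finset.eq_empty_of_forall_notMem fun i hi => pderiv_ne_zero_of_mem_vars hi (h i)⟩

/-- The Euler derivation `∑ x_i ∂/∂x_i`, which multiplies a monomial by its degree. -/
noncomputable def euler (σ R : Type*) [CommSemiring R] :
    Derivation R (MvPolynomial σ R) (MvPolynomial σ R) :=
  mkDerivation R X

@[simp]
theorem euler_X (i : σ) : euler σ R (X i) = X i :=
  mkDerivation_X R X i

theorem euler_monomial (s : σ →₀ ℕ) (r : R) :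
    euler σ R (monomial s r) = s.degree • monomial s r := by
  have hS : ∀ i ∉ s.support, pderiv i (monomial s r) = 0 := fun i hi => by
    rw [pderiv_monomial, Finsupp.notMem_support_iff.1 hi, Nat.cast_zero, mul_zero, monomial_zero]
  calc euler σ R (monomial s r)
      = ∑ i ∈ s.support, X i * pderiv i (monomial s r) := by
        simp only [derivation_apply_eq_sum_pderiv (euler σ R) hS, euler_X, smul_eq_mul,
          mul_comm (pderiv _ _)]
    _ = s.degree • monomial s r := by
        simp only [X_mul_pderiv_monomial, ← Finset.sum_smul, Finsupp.degree_apply]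

variable [Algebra ℚ R]

/-- The operator `p ↦ ∫₀¹ tⁿ p(t x) dt` on polynomials, which divides a monomial of degree `d` by
`d + n + 1`. -/
noncomputable def radialIntegral (n : ℕ) : MvPolynomial σ R →ₗ[R] MvPolynomial σ R :=
  (basisMonomials σ R).constr R fun s =>
    monomial s (algebraMap ℚ R (s.degree + n + 1 : ℚ)⁻¹)

theorem radialIntegral_monomial (n : ℕ) (s : σ →₀ ℕ) (r : R) :
    radialIntegral n (monomial s r) =
      monomial s (algebraMap ℚ R (s.degree + n + 1 : ℚ)⁻¹ * r) := by
  have h := (basisMonomials σ R).constr_basis R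
    (fun s => monomial s (algebraMap ℚ R (s.degree + n + 1 : ℚ)⁻¹)) s
  rw [coe_basisMonomials] at h
  rw [← mul_one r, ← smul_eq_mul, ← smul_monomial, map_smul, radialIntegral, h, smul_monomial,
    smul_eq_mul, smul_eq_mul, mul_one, mul_comm]

theorem pderiv_radialIntegral (n : ℕ) (i : σ) (p : MvPolynomial σ R) :
    pderiv i (radialIntegral n p) = radialIntegral (n + 1) (pderiv i p) := by
  suffices h : (pderiv i).toLinearMap ∘ₗ radialIntegral n =
      radialIntegral (n + 1) ∘ₗ (pderiv i : Derivation R (MvPolynomial σ R) _).toLinearMap from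
    LinearMap.congr_fun h p
  refine linearMap_ext fun s => LinearMap.ext_ring ?_
  simp only [LinearMap.comp_apply, Derivation.coeFn_coe, radialIntegral_monomial, pderiv_monomial]
  rcases eq_or_ne (s i) 0 with hi | hi
  · simp [hi]
  · have hle : Finsupp.single i 1 ≤ s := Finsupp.single_le_iff.2 (Nat.one_le_iff_ne_zero.2 hi)
    have hdeg : s.degree = (s - Finsupp.single i 1).degree + 1 := by
      nth_rw 1 [← tsub_add_cancel_of_le hle, map_add, Finsupp.degree_single]
    rw [hdeg]
    push_cast
    ring_nf

theorem radialIntegral_add_euler_radialIntegral (p : MvPolynomial σ R) :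
    radialIntegral 0 p + euler σ R (radialIntegral 0 p) = p := by
  suffices h : radialIntegral 0 + (euler σ R).toLinearMap ∘ₗ radialIntegral 0 = LinearMap.id from
    LinearMap.congr_fun h p
  refine linearMap_ext fun s => LinearMap.ext_ring ?_
  have hs : (1 + s.degree : ℚ) * (s.degree + 0 + 1 : ℚ)⁻¹ = 1 := by
    rw [add_zero, add_comm, mul_inv_cancel₀ (by positivity)]
  have hR : (1 + s.degree : R) * algebraMap ℚ R (s.degree + 0 + 1 : ℚ)⁻¹ = 1 := by
    simpa only [map_mul, map_add, map_one, map_natCast] using congrArg (algebraMap ℚ R) hs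
  simp only [LinearMap.add_apply, LinearMap.comp_apply, Derivation.coeFn_coe, LinearMap.id_apply,
    radialIntegral_monomial, euler_monomial, ← Nat.cast_smul_eq_nsmul R, smul_monomial, smul_eq_mul,
    mul_one, Nat.cast_zero]
  rw [← map_add, ← hR, add_mul, one_mul]

-- The Poincaré lemma, with the primitive `∑ x_j ∫₀¹ g_j(t x) dt` of the closed form `∑ g_j dx_j`.
theorem exists_forall_pderiv_eq {g : σ → MvPolynomial σ R} (hfin : g.support.Finite)
    (hclosed : ∀ i j, pderiv i (g j) = pderiv j (g i)) :
    ∃ p : MvPolynomial σ R, ∀ i, pderiv i p = g i := by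
  classical
  have hsymm : ∀ i j, pderiv i (radialIntegral 0 (g j)) = pderiv j (radialIntegral 0 (g i)) :=
    fun i j => by rw [pderiv_radialIntegral, pderiv_radialIntegral, hclosed]
  have hzero : ∀ j ∉ hfin.toFinset, g j = 0 := by simp
  refine ⟨∑ j ∈ hfin.toFinset, radialIntegral 0 (g j) * X j, fun i => ?_⟩
  have hterm : ∀ j, pderiv i (radialIntegral 0 (g j) * X j) =
      (if j = i then radialIntegral 0 (g i) else 0) +
        pderiv j (radialIntegral 0 (g i)) • euler σ R (X j) := fun j => by
    rw [Derivation.leibniz, hsymm, pderiv_X, Pi.single_apply, euler_X]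
    split_ifs with h <;> simp [h, mul_comm]
  calc pderiv i (∑ j ∈ hfin.toFinset, radialIntegral 0 (g j) * X j)
      = ∑ j ∈ hfin.toFinset, (if j = i then radialIntegral 0 (g i) else 0) +
          ∑ j ∈ hfin.toFinset, pderiv j (radialIntegral 0 (g i)) • euler σ R (X j) := by
        rw [map_sum, ← Finset.sum_add_distrib]
        exact Finset.sum_congr rfl fun j _ => hterm j
    _ = radialIntegral 0 (g i) + euler σ R (radialIntegral 0 (g i)) := by
        rw [← derivation_apply_eq_sum_pderiv (euler σ R) fun j hj => by
          rw [hsymm, hzero j hj, map_zero, map_zero], Finset.sum_ite_eq', ite_eq_left_iff.2]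
        exact fun hi => by rw [hzero i hi, map_zero]
    _ = g i := radialIntegral_add_euler_radialIntegral _

end Polynomial
section Winf

variable {F : Type*} [Field F]

theorem mem_Winf_iff {D : WX F} : D ∈ Winf F ↔ {i | D (X i) ≠ 0}.Finite := by
  refine ⟨fun hD => ?_, fun hD => ?_⟩
  · obtain ⟨n, -, hn⟩ := Set.mem_iUnion.1 hD
    exact (Set.finite_Iio n).subset fun i hi => not_le.1 fun h => hi (hn i h)
  · obtain ⟨n, hn⟩ := (hD.union (hD.biUnion fun i _ => (D (X i)).vars.finite_toSet)).bddAbove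
    refine Set.mem_iUnion.2 ⟨n + 1, fun i _ => ?_, fun i hi => ?_⟩
    · refine mem_supported.2 fun k hk => Nat.lt_succ_of_le (hn (Or.inr ?_))
      have hi : D (X i) ≠ 0 := fun h0 => by simp [h0] at hk
      exact Set.mem_biUnion hi hk
    · by_contra h0
      exact absurd (hn (Or.inl h0)) (not_le.2 hi)

theorem smul_pderiv_apply_X (j k : ℕ) (p : Poly F) :
    (p • pderiv j : WX F) (X k) = if k = j then p else 0 := by
  rw [Derivation.smul_apply, pderiv_X, smul_eq_mul, Pi.single_apply, mul_ite, mul_one, mul_zero]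

theorem smul_pderiv_mem_Winf (j : ℕ) (p : Poly F) : (p • pderiv j : WX F) ∈ Winf F :=
  mem_Winf_iff.2 <| (Set.finite_singleton j).subset fun k =>
    not_imp_comm.1 fun hkj => (smul_pderiv_apply_X j k p).trans (if_neg hkj)

/-- The vector field `p ∂/∂x_j`, as an element of `W_∞(F)` depending linearly on `p`. -/
noncomputable def smulPderiv (j : ℕ) : Poly F →ₗ[F] Winf F where
  toFun p := ⟨p • pderiv j, smul_pderiv_mem_Winf j p⟩
  map_add' p q := Subtype.ext (add_smul p q _)
  map_smul' c p := Subtype.ext (smul_assoc c p _)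

theorem coe_smulPderiv (j : ℕ) (p : Poly F) : (smulPderiv j p : WX F) = p • pderiv j := rfl

theorem smulPderiv_apply_X (j k : ℕ) (p : Poly F) :
    (smulPderiv j p : WX F) (X k) = if k = j then p else 0 :=
  smul_pderiv_apply_X j k p

theorem exists_eq_sum_smulPderiv (x : Winf F) :
    ∃ S : Finset ℕ, x = ∑ j ∈ S, smulPderiv j ((x : WX F) (X j)) := by
  have hx := mem_Winf_iff.1 x.2
  refine ⟨hx.toFinset, Subtype.ext (derivation_ext fun k => ?_)⟩
  have hsum : ∀ f : ℕ → Winf F, ((∑ j ∈ hx.toFinset, f j : Winf F) : WX F) (X k) =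
      ∑ j ∈ hx.toFinset, (f j : WX F) (X k) := fun f => by
    rw [AddSubmonoidClass.coe_finsetSum, ← Derivation.coeFnAddMonoidHom_apply, map_sum,
      Finset.sum_apply]
    rfl
  simp only [hsum, smulPderiv_apply_X, Finset.sum_ite_eq]
  split_ifs with hk
  · rfl
  · exact not_not.1 fun h => hk (hx.mem_toFinset.2 h)

theorem linearMap_Winf_ext {M : Type*} [AddCommMonoid M] [Module F M] {f g : Winf F →ₗ[F] M}
    (h : ∀ j s, f (smulPderiv j (monomial s 1)) = g (smulPderiv j (monomial s 1))) : f = g := by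
  have hj : ∀ j, f ∘ₗ smulPderiv j = g ∘ₗ smulPderiv j := fun j =>
    linearMap_ext fun s => LinearMap.ext_ring (h j s)
  refine LinearMap.ext fun x => ?_
  obtain ⟨S, hS⟩ := exists_eq_sum_smulPderiv x
  rw [hS, map_sum, map_sum]
  exact Finset.sum_congr rfl fun j _ => LinearMap.congr_fun (hj j) _

theorem lie_smulPderiv_apply_X (i k : ℕ) (p : Poly F) (a : WX F) :
    ⁅smulPderiv i p, a⁆ (X k) = p * pderiv i (a (X k)) - if k = i then a p else 0 := by
  rw [LieSubalgebra.coe_bracket_of_module, Derivation.commutator_apply, smulPderiv_apply_X,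
    coe_smulPderiv, Derivation.smul_apply, smul_eq_mul, apply_ite a, map_zero]

theorem lie_smulPderiv_one_apply_X (i k : ℕ) (a : WX F) :
    ⁅smulPderiv i (1 : Poly F), a⁆ (X k) = pderiv i (a (X k)) := by
  rw [lie_smulPderiv_apply_X, one_mul, Derivation.map_one_eq_zero, ite_self, sub_zero]

theorem lie_smulPderiv_one_smulPderiv (i j : ℕ) (p : Poly F) :
    ⁅smulPderiv i (1 : Poly F), smulPderiv j p⁆ = smulPderiv j (pderiv i p) := by
  refine Subtype.ext (derivation_ext fun k => ?_)
  rw [LieSubalgebra.coe_bracket, ← LieSubalgebra.coe_bracket_of_module,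
    lie_smulPderiv_one_apply_X, smulPderiv_apply_X, smulPderiv_apply_X, apply_ite (pderiv i),
    map_zero]

theorem lie_smulPderiv_X_smulPderiv_monomial (i j : ℕ) (s : ℕ →₀ ℕ) (c : F) :
    ⁅smulPderiv i (X i : Poly F), smulPderiv j (monomial s c)⁆ =
      ((s i : F) - if i = j then 1 else 0) • smulPderiv j (monomial s c) := by
  refine Subtype.ext (derivation_ext fun k => ?_)
  rw [LieSubalgebra.coe_bracket, ← LieSubalgebra.coe_bracket_of_module, lie_smulPderiv_apply_X,
    SetLike.val_smul, Derivation.smul_apply, smulPderiv_apply_X, smulPderiv_apply_X, sub_smul]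
  have hX := X_mul_pderiv_monomial (i := i) (m := s) (r := c)
  rw [← Nat.cast_smul_eq_nsmul F] at hX
  rcases eq_or_ne k j with rfl | hkj
  · rcases eq_or_ne i k with rfl | hik
    · simp only [hX, if_true, one_smul]
    · simp only [hX, hik, hik.symm, if_true, if_false, zero_smul, sub_zero]
  · rcases eq_or_ne k i with rfl | hki <;> simp [*]

end Winf

section Derivations

variable {F : Type*} [Field F] (D : LieDerivation F (Winf F) (WX F))

theorem pderiv_apply_smulPderiv_apply_X (i j k : ℕ) (p : Poly F) :
    pderiv i (D (smulPderiv j p) (X k)) =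
      D (smulPderiv j (pderiv i p)) (X k) + ⁅smulPderiv j p, D (smulPderiv i 1)⁆ (X k) := by
  rw [← lie_smulPderiv_one_apply_X, ← lie_smulPderiv_one_smulPderiv, D.apply_lie_eq_sub,
    Derivation.sub_apply, sub_add_cancel]

theorem pderiv_apply_smulPderiv_one_comm (i j k : ℕ) :
    pderiv i (D (smulPderiv j 1) (X k)) = pderiv j (D (smulPderiv i 1) (X k)) := by
  rw [pderiv_apply_smulPderiv_apply_X, pderiv_one, map_zero, map_zero, Derivation.zero_apply,
    zero_add, lie_smulPderiv_one_apply_X]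

-- The idea is to apply `D` to `[∂/∂x_i, x_k ∂/∂x_k] = 0`.
theorem apply_smulPderiv_one_apply_X_eq_zero {i k : ℕ} (hik : i ≠ k)
    (hone : i ∉ (D (smulPderiv k 1) (X k)).vars) (hX : i ∉ (D (smulPderiv k (X k)) (X k)).vars) :
    D (smulPderiv i 1) (X k) = 0 := by
  have h1 : pderiv k (D (smulPderiv i 1) (X k)) = 0 := by
    rw [← pderiv_apply_smulPderiv_one_comm, pderiv_eq_zero_of_notMem_vars hone]
  have h := pderiv_apply_smulPderiv_apply_X D i k k (X k)
  rw [pderiv_eq_zero_of_notMem_vars hX, pderiv_X_of_ne hik.symm, map_zero, map_zero,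
    Derivation.zero_apply, lie_smulPderiv_apply_X, h1, if_pos rfl, mul_zero] at h
  simpa using h

theorem finite_setOf_apply_smulPderiv_one_ne_zero (k : ℕ) :
    {i | D (smulPderiv i 1) (X k) ≠ 0}.Finite := by
  refine ((Set.finite_singleton k).union ((D (smulPderiv k 1) (X k)).vars.finite_toSet.union
    (D (smulPderiv k (X k)) (X k)).vars.finite_toSet)).subset fun i hi => ?_
  by_contra h
  simp only [Set.mem_union, Set.mem_singleton_iff, Finset.mem_coe, not_or] at h
  exact hi (apply_smulPderiv_one_apply_X_eq_zero D h.1 h.2.1 h.2.2)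

variable {D} [CharZero F]

theorem exists_apply_smulPderiv_one_eq_lie :
    ∃ a : WX F, ∀ i, D (smulPderiv i 1) = ⁅smulPderiv i (1 : Poly F), a⁆ := by
  choose p hp using fun k => exists_forall_pderiv_eq
    (finite_setOf_apply_smulPderiv_one_ne_zero D k) (pderiv_apply_smulPderiv_one_comm D · · k)
  exact ⟨mkDerivation F p, fun i => derivation_ext fun k => by
    rw [lie_smulPderiv_one_apply_X, mkDerivation_X, hp]⟩

theorem exists_apply_smulPderiv_eq_C (hone : ∀ i, D (smulPderiv i 1) = 0) {j : ℕ} {p : Poly F}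
    (hp : ∀ i, D (smulPderiv j (pderiv i p)) = 0) :
    ∃ c : ℕ → F, ∀ k, D (smulPderiv j p) (X k) = C (c k) :=
  Classical.skolem.1 fun k => exists_eq_C_of_pderiv_eq_zero fun i => by
    rw [pderiv_apply_smulPderiv_apply_X, hp, hone, lie_zero, Derivation.zero_apply, add_zero]

theorem exists_apply_smulPderiv_X_eq_lie (hone : ∀ i, D (smulPderiv i 1) = 0) :
    ∃ c : ℕ → F, ∀ i, D (smulPderiv i (X i)) =
      ⁅smulPderiv i (X i : Poly F), mkDerivation F fun k => (C (c k) : Poly F)⁆ := by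
  have hconst : ∀ i, ∃ c : ℕ → F, ∀ k, D (smulPderiv i (X i)) (X k) = C (c k) := fun i =>
    exists_apply_smulPderiv_eq_C hone fun l => by
      rw [pderiv_X, Pi.single_apply]
      split_ifs
      · exact hone i
      · rw [map_zero, map_zero]
  choose c hc using hconst
  have hoff : ∀ i k, k ≠ i → c i k = 0 := fun i k hki => by
    have hcomm : ⁅smulPderiv i (X i : Poly F), smulPderiv k (X k : Poly F)⁆ = 0 := by
      have h := lie_smulPderiv_X_smulPderiv_monomial i k (Finsupp.single k 1) (1 : F)
      rwa [if_neg hki.symm, Finsupp.single_eq_of_ne hki.symm, Nat.cast_zero, sub_zero,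
        zero_smul] at h
    have h := DFunLike.congr_fun
      (D.apply_lie_eq_sub (smulPderiv i (X i)) (smulPderiv k (X k))) (X k)
    rw [hcomm, map_zero, Derivation.zero_apply, Derivation.sub_apply, lie_smulPderiv_apply_X,
      lie_smulPderiv_apply_X, if_neg hki, if_pos rfl] at h
    simpa [hc] using h.symm
  refine ⟨fun k => -c k k, fun i => derivation_ext fun k => ?_⟩
  rw [lie_smulPderiv_apply_X, mkDerivation_X, mkDerivation_X, pderiv_C, mul_zero, zero_sub, hc]
  split_ifs with hki
  · rw [hki, map_neg, neg_neg]
  · rw [hoff i k hki, map_zero, neg_zero]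

-- `D` preserves the weights under all `x_i ∂/∂x_i`, so a nonzero `c_k` forces `x^s ∂/∂x_j` and
-- `∂/∂x_k` to have the same weight, `s + e_k = e_j`, which is impossible for `s ≠ 0`.
theorem apply_smulPderiv_monomial_eq_zero_of_eq_C (hX : ∀ i, D (smulPderiv i (X i)) = 0) {j : ℕ}
    {s : ℕ →₀ ℕ} (hs : s ≠ 0) {c : ℕ → F}
    (hc : ∀ k, D (smulPderiv j (monomial s 1)) (X k) = C (c k)) :
    D (smulPderiv j (monomial s 1)) = 0 := by
  refine derivation_ext fun k => ?_
  have hweight : ∀ i, ((s i : F) + (if k = i then 1 else 0) - if i = j then 1 else 0) * c k = 0 :=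
    fun i => by
      have h := DFunLike.congr_fun
        (D.apply_lie_eq_sub (smulPderiv i (X i)) (smulPderiv j (monomial s 1))) (X k)
      rw [lie_smulPderiv_X_smulPderiv_monomial, hX, lie_zero, sub_zero, map_smul,
        lie_smulPderiv_apply_X, Derivation.smul_apply, hc, pderiv_C, mul_zero, zero_sub,
        smul_eq_C_mul, ← C_mul] at h
      refine C_injective ℕ F ?_
      rw [add_sub_right_comm, add_mul, C_add, h]
      split_ifs with hki
      · simp [hki, hc]
      · simp
  by_contra hne
  have hck : c k ≠ 0 := fun h0 => hne (by rw [hc, h0, C_0, Derivation.zero_apply])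
  have heq : s + Finsupp.single k 1 = Finsupp.single j 1 := by
    ext i
    have h := (mul_eq_zero.1 (hweight i)).resolve_right hck
    rw [Finsupp.add_apply, Finsupp.single_apply, Finsupp.single_apply, ← Nat.cast_inj (R := F)]
    simpa [eq_comm (a := j)] using sub_eq_zero.1 h
  refine hs ((Finsupp.degree_eq_zero_iff _).1 ?_)
  simpa using congrArg Finsupp.degree heq

theorem eq_zero_of_apply_smulPderiv_eq_zero (hone : ∀ i, D (smulPderiv i 1) = 0)
    (hX : ∀ i, D (smulPderiv i (X i)) = 0) : D = 0 := by
  suffices h : ∀ s j, D (smulPderiv j (monomial s 1)) = 0 from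
    LieDerivation.ext <| LinearMap.congr_fun <|
      linearMap_Winf_ext (f := (D : Winf F →ₗ[F] WX F)) (g := 0) fun j s => h s j
  intro s
  induction s using WellFoundedLT.induction with
  | ind s ih =>
  intro j
  rcases eq_or_ne s 0 with rfl | hs
  · exact hone j
  have hlower : ∀ i, D (smulPderiv j (pderiv i (monomial s 1))) = 0 := fun i => by
    rw [pderiv_monomial, one_mul]
    rcases eq_or_ne (s i) 0 with hi | hi
    · rw [hi, Nat.cast_zero, monomial_zero, map_zero, map_zero]
    have hlt : s - Finsupp.single i 1 < s :=
      tsub_le_self.lt_of_ne fun h => by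
        have hsi := DFunLike.congr_fun h i
        rw [Finsupp.tsub_apply, Finsupp.single_eq_same] at hsi
        omega
    rw [← mul_one (s i : F), ← smul_eq_mul, ← smul_monomial, map_smul, map_smul, ih _ hlt,
      smul_zero]
  obtain ⟨c, hc⟩ := exists_apply_smulPderiv_eq_C hone hlower
  exact apply_smulPderiv_monomial_eq_zero_of_eq_C hX hs hc

variable (D) in
theorem exists_eq_inner : ∃ a : WX F, D = LieDerivation.inner F (Winf F) (WX F) a := by
  obtain ⟨a, ha⟩ := exists_apply_smulPderiv_one_eq_lie (D := D)
  set E := D - LieDerivation.inner F (Winf F) (WX F) a with hE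
  have hone : ∀ i, E (smulPderiv i 1) = 0 := fun i => by
    rw [hE, LieDerivation.sub_apply, ha, LieDerivation.inner_apply_apply, sub_self]
  obtain ⟨c, hc⟩ := exists_apply_smulPderiv_X_eq_lie hone
  set b : WX F := mkDerivation F fun k => C (c k) with hb
  have hEb : E - LieDerivation.inner F (Winf F) (WX F) b = 0 := by
    refine eq_zero_of_apply_smulPderiv_eq_zero (fun i => derivation_ext fun k => ?_) fun i => ?_
    · rw [LieDerivation.sub_apply, hone, zero_sub, LieDerivation.inner_apply_apply,
        Derivation.neg_apply, lie_smulPderiv_one_apply_X, hb, mkDerivation_X, pderiv_C, neg_zero,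
        Derivation.zero_apply]
    · rw [LieDerivation.sub_apply, hc, LieDerivation.inner_apply_apply, sub_self]
  refine ⟨a + b, ?_⟩
  rw [map_add, ← sub_eq_zero, ← sub_sub, ← hE, hEb]

end Derivations

section Normalizer

variable {F : Type*} [Field F]

theorem Wfin_le_normalizer_Winf : Wfin F ≤ (Winf F).normalizer := by
  intro a ha
  refine (LieSubalgebra.mem_normalizer_iff' _ _).2 fun x hx => mem_Winf_iff.2 ?_
  have hx := mem_Winf_iff.1 hx
  refine (hx.union (hx.biUnion fun n _ => ha n)).subset fun i hi => ?_
  by_contra h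
  simp only [Set.mem_union, Set.mem_iUnion, Set.mem_ofPred_eq, not_or, not_exists, not_not] at h
  have hxa : x (a (X i)) = 0 :=
    derivation_eq_zero_of_forall_mem_vars fun n hn => by_contra fun hxn => h.2 n hxn hn
  exact hi (by rw [Derivation.commutator_apply, h.1, hxa, map_zero, sub_zero])

theorem normalizer_Winf [CharZero F] : (Winf F).normalizer = Wfin F := by
  refine le_antisymm (fun a ha n => ?_) Wfin_le_normalizer_Winf
  have h := mem_Winf_iff.1 ((LieSubalgebra.mem_normalizer_iff' _ _).1 ha _ (smulPderiv n 1).2)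
  refine h.subset fun i hi => ?_
  rw [Set.mem_ofPred_eq, ← LieSubalgebra.coe_bracket_of_module, lie_smulPderiv_one_apply_X]
  exact pderiv_ne_zero_of_mem_vars hi

theorem euler_mem_Wfin : euler ℕ F ∈ Wfin F := fun n => by
  simp

theorem not_exists_normalizerDerivation_euler_eq_lie :
    ¬ ∃ b : Winf F, ∀ x : Winf F,
      normalizerDerivation (Wfin_le_normalizer_Winf (euler_mem_Wfin (F := F))) x = ⁅x, b⁆ := by
  rintro ⟨b, hb⟩
  obtain ⟨n, hn⟩ := (mem_Winf_iff.1 b.2).exists_notMem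
  have h := DFunLike.congr_fun (congrArg Subtype.val (hb (smulPderiv n 1))) (X n)
  have hbn : b.1 (X n) = 0 := not_not.1 hn
  rw [coe_normalizerDerivation_apply, LieSubalgebra.coe_bracket,
    ← LieSubalgebra.coe_bracket_of_module, ← LieSubalgebra.coe_bracket_of_module,
    lie_smulPderiv_one_apply_X, lie_smulPderiv_one_apply_X, euler_X, pderiv_X_self, hbn,
    map_zero] at h
  exact one_ne_zero h

end Normalizer

end PolyVect

theorem theorem1 (F : Type*) [Field F] [CharZero F] :
    (∀ D : LieDerivation F (PolyVect.Winf F) (PolyVect.Winf F),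
      ∃ a ∈ PolyVect.Wfin F, ∀ x : PolyVect.Winf F,
        ((D x : PolyVect.Winf F) : PolyVect.WX F) = ⁅(x : PolyVect.WX F), a⁆) ∧
    ¬ ∀ D : LieDerivation F (PolyVect.Winf F) (PolyVect.Winf F),
      ∃ b : PolyVect.Winf F, ∀ x : PolyVect.Winf F, D x = ⁅x, b⁆ := by
  refine ⟨fun D => ?_, fun h => PolyVect.not_exists_normalizerDerivation_euler_eq_lie (h _)⟩
  obtain ⟨a, ha⟩ := PolyVect.exists_eq_inner (PolyVect.ambientDerivation D)
  have hD : ∀ x : PolyVect.Winf F, (D x : PolyVect.WX F) = ⁅(x : PolyVect.WX F), a⁆ :=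
    LieDerivation.congr_fun ha
  refine ⟨a, ?_, hD⟩
  rw [← PolyVect.normalizer_Winf, LieSubalgebra.mem_normalizer_iff']
  exact fun x hx => hD ⟨x, hx⟩ ▸ (D ⟨x, hx⟩).2
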